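/- Let $K$ be an algebraically closed field and $R=K[x_1,\dots,x_n]$. An affine cell is a set $X\subseteq K^n$ of the form $X=Z\setminus V(g)$ with $Z$ an algebraic set and $g\in R$, together with a distinguished ideal $I(X)\subseteq R$, which may be any ideal (not necessarily radical) whose zero set $V(I(X))$ is the Zariski closure $\overline X$. It is equidimensional if all irreducible components of $\overline X$ have the same dimension. "For a generic affine linear subspace $L\subseteq K^n$ of codimension $d$" means: for $L=\{x\in K^n : b_i+\sum_{j} a_{ij}x_j=0,\ i=1,\dots,d\}$, for all coefficients $(a_{ij},b_i)$ in a nonempty Zariski open subset of $K^{d(n+1)}$, for all of which $L$ is nonempty of codimension exactly $d$. Let $X$ be an equidimensional affine cell of dimension $d\ge 0$ (so $X\neq\varnothing$), and let $f\in R$. Then, for a generic affine linear subspace $L\subseteq K^n$ of codimension $d$, the following statements hold, for every choice of the distinguished ideals $I(X\cap L)$ and $I(X\setminus V(f))$ of the affine cells $X\cap L$ and $X\setminus V(f)$: 1. $f\in\operatorname{rad} I(X)$ if and only if $f\in\operatorname{rad} I(X\cap L)$. 2. $I(X\setminus V(f))\subseteq\operatorname{rad} I(X)$ if and only if $X\cap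 L\cap V(f)=\varnothing$. -/

import Mathlib

open MvPolynomial

noncomputable section

/-- The Zariski topology on `Kⁿ`: the closed sets are the common zero sets of ideals of
`K[x₁, …, xₙ]`. -/
@[reducible] def zariskiTopology (K : Type*) [Field K] (n : ℕ) : TopologicalSpace (Fin n → K) :=
  TopologicalSpace.ofClosed {Z | ∃ I : Ideal (MvPolynomial (Fin n) K), Z = zeroLocus K I}
    ⟨⊤, by simp⟩
    (by
      intro A hA
      refine ⟨⨆ J ∈ {J : Ideal (MvPolynomial (Fin n) K) | zeroLocus K J ∈ A}, J, ?_⟩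
      apply Set.Subset.antisymm
      · refine le_zeroLocus_iff_le_vanishingIdeal.2 (iSup₂_le fun J hJ => ?_)
        exact le_zeroLocus_iff_le_vanishingIdeal.1 (Set.sInter_subset_of_mem hJ)
      · intro x hx Z hZ
        obtain ⟨J, rfl⟩ := hA hZ
        exact zeroLocus_anti_mono (le_iSup₂_of_le J hZ le_rfl) hx)
    (by
      rintro _ ⟨I, rfl⟩ _ ⟨J, rfl⟩
      refine ⟨I * J, Set.Subset.antisymm ?_ ?_⟩
      · exact Set.union_subset (zeroLocus_anti_mono Ideal.mul_le_left)
          (zeroLocus_anti_mono Ideal.mul_le_right)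
      · intro x hx
        by_contra hcon
        rw [Set.mem_union, not_or, mem_zeroLocus_iff, mem_zeroLocus_iff] at hcon
        push Not at hcon
        obtain ⟨⟨p, hp, hp0⟩, q, hq, hq0⟩ := hcon
        have h := hx (p * q) (Ideal.mul_mem_mul hp hq)
        rw [map_mul] at h
        exact (mul_ne_zero hp0 hq0) h)

section Affine

variable {K : Type*} [Field K] {n : ℕ}

/-- The Zariski closure of a subset of `Kⁿ`. -/
def zariskiClosure (S : Set (Fin n → K)) : Set (Fin n → K) :=
  @closure _ (zariskiTopology K n) S

theorem isClosed_zariski_iff {S : Set (Fin n → K)} :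
    @IsClosed _ (zariskiTopology K n) S ↔
      ∃ I : Ideal (MvPolynomial (Fin n) K), S = zeroLocus K I := by
  let := zariskiTopology K n
  rw [← isOpen_compl_iff]
  change Sᶜᶜ ∈ {Z | ∃ I : Ideal (MvPolynomial (Fin n) K), Z = zeroLocus K I} ↔ _
  rw [compl_compl]
  rfl

theorem zariskiClosure_eq (S : Set (Fin n → K)) :
    zariskiClosure S = zeroLocus K (vanishingIdeal K S) := by
  let := zariskiTopology K n
  apply Set.Subset.antisymm
  · exact closure_minimal (zeroLocus_vanishingIdeal_le S) (isClosed_zariski_iff.2 ⟨_, rfl⟩)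
  · obtain ⟨I, hI⟩ := isClosed_zariski_iff.1 (isClosed_closure (X := Fin n → K) (s := S))
    change _ ⊆ closure S
    rw [hI]
    refine zeroLocus_anti_mono (le_zeroLocus_iff_le_vanishingIdeal.1 ?_)
    rw [← hI]
    exact subset_closure

/-- The hypersurface `V(f)`. -/
def hypersurface (f : MvPolynomial (Fin n) K) : Set (Fin n → K) := {x | eval x f = 0}

/-- The (Krull) dimension of a subset `S` of `Kⁿ`, i.e. of its Zariski closure: the Krull
dimension of the coordinate ring `K[x₁, …, xₙ] / {p | p vanishes on S}`. It is `⊥` for `S = ∅`. -/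
def zariskiDim (S : Set (Fin n → K)) : WithBot ℕ∞ :=
  ringKrullDim (MvPolynomial (Fin n) K ⧸ vanishingIdeal K S)

/-- `C` is an irreducible component of `Z`: a maximal irreducible subset of `Z` for the Zariski
topology. -/
def IsIrreducibleComponent (C Z : Set (Fin n → K)) : Prop :=
  Maximal (fun T : Set (Fin n → K) => @IsIrreducible _ (zariskiTopology K n) T ∧ T ⊆ Z) C

/-- Sets of the form `Z ∖ V(g)` with `Z` algebraic and `g` a polynomial. -/
def IsAffineCell (S : Set (Fin n → K)) : Prop :=
  ∃ (J : Ideal (MvPolynomial (Fin n) K)) (g : MvPolynomial (Fin n) K),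
    S = zeroLocus K J \ hypersurface g

variable (K n) in
/-- An affine cell in `Kⁿ`, together with its distinguished ideal `I(X)`, which is any ideal
(not necessarily radical) whose zero set is the Zariski closure of `X`. -/
structure AffineCell where
  carrier : Set (Fin n → K)
  isAffineCell : IsAffineCell carrier
  ideal : Ideal (MvPolynomial (Fin n) K)
  zeroLocus_ideal : zeroLocus K ideal = zariskiClosure carrier

/-- All irreducible components of the Zariski closure have the same dimension. -/
def AffineCell.IsEquidimensional (X : AffineCell K n) : Prop :=
  ∀ C C' : Set (Fin n → K), IsIrreducibleComponent C (zariskiClosure X.carrier) →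
    IsIrreducibleComponent C' (zariskiClosure X.carrier) → zariskiDim C = zariskiDim C'

/-- The affine linear subspace of `Kⁿ` cut out by the `d` equations
`a (i, none) + ∑ j, a (i, some j) * x j = 0`. -/
def linearSection {d : ℕ} (a : Fin d × Option (Fin n) → K) : AffineSubspace K (Fin n → K) where
  carrier := {x | ∀ i : Fin d, a (i, none) + ∑ j, a (i, some j) * x j = 0}
  smul_vsub_vadd_mem' := by
    intro c p q r hp hq hr i
    have h : a (i, none) + ∑ j, a (i, some j) * (c • (p -ᵥ q) +ᵥ r) j =
        c * ((a (i, none) + ∑ j, a (i, some j) * p j) -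
          (a (i, none) + ∑ j, a (i, some j) * q j)) +
          (a (i, none) + ∑ j, a (i, some j) * r j) := by
      simp only [vsub_eq_sub, vadd_eq_add, Pi.add_apply, Pi.smul_apply, Pi.sub_apply,
        smul_eq_mul, mul_add, add_sub_add_left_eq_sub, ← Finset.sum_sub_distrib,
        Finset.mul_sum, Finset.sum_add_distrib]
      rw [add_left_comm]
      congr 1
      exact Finset.sum_congr rfl fun j _ => by ring
    rw [h, hp i, hq i, hr i]
    simp

/-- A generic affine linear subspace of codimension `d` of `Kⁿ` has the property `Q`: there is a
nonempty Zariski open set of coefficient systems of `d` affine linear equations, all of which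
define subspaces that have codimension `d` and the property `Q`. -/
def ForGenericSubspace (d : ℕ) (Q : AffineSubspace K (Fin n → K) → Prop) : Prop :=
  ∃ P : MvPolynomial (Fin d × Option (Fin n)) K, P ≠ 0 ∧
    ∀ a : Fin d × Option (Fin n) → K, eval a P ≠ 0 →
      ((linearSection a : Set (Fin n → K)).Nonempty ∧
        Module.finrank K (linearSection a).direction + d = n) ∧
      Q (linearSection a)

/-- Every set of the form `Z ∖ V(g)` underlies an affine cell, e.g. with its vanishing ideal. -/
def AffineCell.ofSet (S : Set (Fin n → K)) (hS : IsAffineCell S) : AffineCell K n where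
  carrier := S
  isAffineCell := hS
  ideal := vanishingIdeal K S
  zeroLocus_ideal := (zariskiClosure_eq S).symm

/-- `X ∖ V(f)` is again of the form `Z ∖ V(g)`. -/
theorem IsAffineCell.diff_hypersurface {S : Set (Fin n → K)} (hS : IsAffineCell S)
    (f : MvPolynomial (Fin n) K) : IsAffineCell (S \ hypersurface f) := by
  obtain ⟨J, g, rfl⟩ := hS
  refine ⟨J, g * f, ?_⟩
  ext x
  simp only [hypersurface, Set.mem_sdiff, Set.mem_ofPred_eq, map_mul, mul_eq_zero, not_or, and_assoc]

/-- `X ∩ L` is again of the form `Z ∖ V(g)`. -/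
theorem IsAffineCell.inter_linearSection {S : Set (Fin n → K)} (hS : IsAffineCell S) {d : ℕ}
    (a : Fin d × Option (Fin n) → K) :
    IsAffineCell (S ∩ (linearSection a : Set (Fin n → K))) := by
  obtain ⟨J, g, rfl⟩ := hS
  refine ⟨J ⊔ Ideal.span (Set.range fun i : Fin d =>
    (C (a (i, none)) + ∑ j, C (a (i, some j)) * X j : MvPolynomial (Fin n) K)), g, ?_⟩
  rw [zeroLocus_vanishingIdeal_galoisConnection.l_sup, zeroLocus_span]
  ext x
  simp only [Set.mem_inter_iff, Set.mem_sdiff]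
  have h : x ∈ (linearSection a : Set (Fin n → K)) ↔
      ∀ i : Fin d, a (i, none) + ∑ j, a (i, some j) * x j = 0 := Iff.rfl
  have h2 : ∀ A B : (Set (Fin n → K))ᵒᵈ, x ∈ (OrderDual.ofDual (A ⊔ B)) ↔
    x ∈ OrderDual.ofDual A ∧ x ∈ OrderDual.ofDual B := fun _ _ => Iff.rfl
  rw [h]
  refine Iff.trans ?_ (and_congr_left' (h2 _ _).symm)
  simp only [OrderDual.ofDual, Set.forall_mem_range, map_add, map_sum, map_mul, aeval_C, aeval_X, Algebra.algebraMap_self,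
    RingHom.id_apply]
  tauto

end Affine

end

/-! By the Nullstellensatz the radical of any distinguished ideal is the vanishing ideal of the
cell, so both statements concern only points: whether `f` vanishes on `X`, and whether `X ∖ V(f)` is
dense in `X`, i.e. whether `f` vanishes on no component of the closure. Both follow once a generic
`L` meets every component in a point of `X`, and on `L` the polynomial `f` has no zero on any
component where it is not identically zero.

Let `A` be the coordinate ring of a component, of dimension `d`. The pairs (point of the component,
system of equations it satisfies) form a variety with coordinate ring `A[a_ij]`: the constant terms
are forced to be `-∑ a_ij x_j`. Its dimension `dn + d` is that of the space of all coefficient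
systems, and `algebraicIndependent_genericCoeff` says that its projection there is dominant. Hence
`A[a_ij]` is algebraic over the ring of coefficients: generic systems lift to points
(`exists_forall_ringHom_extend`), and a nonzero `h` in `A` divides a nonzero polynomial in the
coefficients, off whose zeros `h` cannot vanish on the section. Multiplying the conditions over the
finitely many components gives one open set. -/

/-! ### Dimension, and extension of homomorphisms along algebraic extensions -/

/-- Incomparability keeps contracted chains of primes strict; lying over and going up lift chains.
-/
theorem Algebra.IsIntegral.ringKrullDim_eq {R S : Type*} [CommRing R] [CommRing S] [Algebra R S]
    [Algebra.IsIntegral R S] [FaithfulSMul R S] : ringKrullDim S = ringKrullDim R := by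
  apply le_antisymm
  · refine Order.krullDim_le_of_strictMono (PrimeSpectrum.comap (algebraMap R S)) fun P Q h => ?_
    exact Ideal.IsIntegral.comap_lt_comap (R := R) (I := P.asIdeal) (J := Q.asIdeal) h
  · refine iSup_le fun l => ?_
    obtain ⟨⟨Q, hQ, hQl⟩⟩ := Ideal.nonempty_primesOver (S := S) (l.head).asIdeal
    obtain ⟨L, hL, -⟩ := Ideal.exists_ltSeries_of_hasGoingUp l Q
    rw [← hL]
    exact le_iSup (fun p : LTSeries (PrimeSpectrum S) => (p.length : WithBot ℕ∞)) L

/-- The Krull dimension of a finitely generated domain over a field is its transcendence degree. -/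
theorem ringKrullDim_eq_trdeg (K A : Type*) [Field K] [CommRing A] [IsDomain A] [Algebra K A]
    [Algebra.FiniteType K A] :
    ∃ s : ℕ, Algebra.trdeg K A = s ∧ ringKrullDim A = s := by
  -- Noether normalization: both invariants equal the number `s` of variables.
  obtain ⟨s, g, hg, hint⟩ := exists_integral_inj_algHom_of_fg K A
  refine ⟨s, ?_, ?_⟩
  · have hind : AlgebraicIndependent K (fun i => g (X i)) := by
      have : aeval (fun i => g (X i)) = g := by ext; simp
      rwa [AlgebraicIndependent, this]
    have hb : IsTranscendenceBasis K (fun i => g (X i)) := by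
      rw [hind.isTranscendenceBasis_iff_isAlgebraic]
      have hrange : Algebra.adjoin K (Set.range fun i => g (X i)) = g.range := by
        rw [show (Set.range fun i => g (X i)) = g '' Set.range X from Set.range_comp g X,
          ← AlgHom.map_adjoin, adjoin_range_X, Algebra.map_top]
      rw [hrange]
      refine ⟨fun a => ?_⟩
      obtain ⟨p, hp, hpa⟩ := hint a
      refine ⟨p.map g.rangeRestrict.toRingHom, ?_, ?_⟩
      · exact (hp.map _).ne_zero
      · rw [Polynomial.aeval_def, Polynomial.eval₂_map]
        exact hpa
    have := hb.lift_cardinalMk_eq_trdeg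
    simpa using this.symm
  · algebraize [g.toRingHom]
    have : Algebra.IsIntegral (MvPolynomial (Fin s) K) A := ⟨hint⟩
    have : FaithfulSMul (MvPolynomial (Fin s) K) A :=
      (faithfulSMul_iff_algebraMap_injective _ _).2 hg
    rw [Algebra.IsIntegral.ringKrullDim_eq (R := MvPolynomial (Fin s) K),
      MvPolynomial.ringKrullDim_of_isNoetherianRing]
    simp

/-- If all minimal primes over `I` have the same dimension, this is the dimension of `I`. -/
theorem ringKrullDim_quotient_minimalPrime_eq {R : Type*} [CommRing R] {I p : Ideal R}
    (hI : ∀ q ∈ I.minimalPrimes, ringKrullDim (R ⧸ q) = ringKrullDim (R ⧸ p))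
    (hp : p ∈ I.minimalPrimes) : ringKrullDim (R ⧸ p) = ringKrullDim (R ⧸ I) := by
  apply le_antisymm
  · exact ringKrullDim_le_of_surjective (Ideal.Quotient.factor hp.1.2)
      (Ideal.Quotient.factor_surjective hp.1.2)
  · rw [ringKrullDim_quotient I]
    refine iSup_le fun l => ?_
    -- A chain of primes over `I` lies entirely above any minimal prime below its first term.
    obtain ⟨q, hq, hql⟩ := Ideal.exists_minimalPrimes_le (I := I) (J := l.head.1.asIdeal) l.head.2
    rw [← hI q hq, ringKrullDim_quotient q]
    let l' : LTSeries (PrimeSpectrum.zeroLocus (q : Set R)) :=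
      { length := l.length
        toFun := fun i => ⟨(l i).1, hql.trans (l.head_le i)⟩
        step := fun i => l.step i }
    exact le_iSup (fun p : LTSeries (PrimeSpectrum.zeroLocus (q : Set R)) =>
      (p.length : WithBot ℕ∞)) l'

/-- For a prime `Q` over the kernel of `φ`, the domain `N ⧸ Q` is algebraic over the image of `φ`,
hence maps to the algebraically closed field `K`. -/
theorem exists_ringHom_extend_of_isIntegral {B N K : Type*} [CommRing B] [CommRing N] [Algebra B N]
    [FaithfulSMul B N] [Algebra.IsIntegral B N] [Field K] [IsAlgClosed K] (φ : B →+* K) :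
    ∃ χ : N →+* K, χ.comp (algebraMap B N) = φ := by
  have : (RingHom.ker φ).IsPrime := RingHom.ker_isPrime φ
  obtain ⟨⟨Q, hQ, hQl⟩⟩ := Ideal.nonempty_primesOver (S := N) (RingHom.ker φ)
  let φ' : B ⧸ RingHom.ker φ →+* K := RingHom.kerLift φ
  let : Algebra (B ⧸ RingHom.ker φ) K := φ'.toAlgebra
  have : FaithfulSMul (B ⧸ RingHom.ker φ) K :=
    (faithfulSMul_iff_algebraMap_injective _ _).2 (RingHom.kerLift_injective φ)
  have : Module.IsTorsionFree (B ⧸ RingHom.ker φ) (N ⧸ Q) :=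
    Module.isTorsionFree_iff_faithfulSMul.2 inferInstance
  let e : N ⧸ Q →ₐ[B ⧸ RingHom.ker φ] K := IsAlgClosed.lift
  refine ⟨e.toRingHom.comp (Ideal.Quotient.mk Q), ?_⟩
  ext b
  exact e.commutes (Ideal.Quotient.mk _ b)
/-- A finitely generated algebraic extension of domains: generic homomorphisms to an algebraically
closed field extend. -/
theorem exists_forall_ringHom_extend (B M K : Type*) [CommRing B] [IsDomain B] [CommRing M]
    [IsDomain M] [Algebra B M] [FaithfulSMul B M] [Algebra.IsAlgebraic B M]
    [Algebra.FiniteType B M] [Field K] [IsAlgClosed K] :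
    ∃ c : B, c ≠ 0 ∧ ∀ φ : B →+* K, φ c ≠ 0 → ∃ ψ : M →+* K, ψ.comp (algebraMap B M) = φ := by
  classical
  obtain ⟨S, hS⟩ := ‹Algebra.FiniteType B M›.out
  have hex : ∀ m : M, ∃ c : B, c ≠ 0 ∧ IsIntegral B (c • m) := fun m => by
    obtain ⟨c, hc, h⟩ := (Algebra.IsAlgebraic.isAlgebraic (R := B) m).exists_integral_multiple
    exact ⟨c, hc, h⟩
  choose l hl0 hl using hex
  -- A common denominator: after inverting `c`, every element of `M` becomes integral, so `M` and
  -- the integral closure of `B` have the same localization.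
  set c : B := ∏ s ∈ S, l s with hc
  have hmul : ∀ m : M, ∃ k : ℕ, IsIntegral B (c ^ k • m) := fun m => by
    have hm : m ∈ Algebra.adjoin B (S : Set M) := by rw [hS]; trivial
    induction hm using Algebra.adjoin_induction with
    | mem x hx =>
      refine ⟨1, ?_⟩
      rw [pow_one, hc, ← Finset.prod_erase_mul S l hx, mul_smul]
      exact (hl x).smul _
    | algebraMap r => exact ⟨0, by simpa using isIntegral_algebraMap⟩
    | add x y _ _ hx hy =>
      obtain ⟨i, hi⟩ := hx
      obtain ⟨j, hj⟩ := hy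
      refine ⟨i + j, ?_⟩
      rw [smul_add]
      refine IsIntegral.add ?_ ?_
      · rw [pow_add, mul_comm, mul_smul]; exact hi.smul _
      · rw [pow_add, mul_smul]; exact hj.smul _
    | mul x y _ _ hx hy =>
      obtain ⟨i, hi⟩ := hx
      obtain ⟨j, hj⟩ := hy
      refine ⟨i + j, ?_⟩
      rw [pow_add, ← smul_mul_smul_comm]
      exact hi.mul hj
  have hc0 : c ≠ 0 := Finset.prod_ne_zero_iff.2 fun s _ => hl0 s
  refine ⟨c, hc0, fun φ hφ => ?_⟩
  let N := integralClosure B M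
  have : FaithfulSMul B N := (faithfulSMul_iff_algebraMap_injective _ _).2 fun x y h =>
    FaithfulSMul.algebraMap_injective B M (congrArg Subtype.val h)
  -- extend `φ` to the integral closure
  obtain ⟨χ, hχ⟩ := exists_ringHom_extend_of_isIntegral (N := N) φ
  -- `M` embeds into a localization of the integral closure
  let cN : N := algebraMap B N c
  let L := Localization.Away (algebraMap B M c)
  have hinj : Function.Injective (algebraMap M L) :=
    IsLocalization.injective _ (powers_le_nonZeroDivisors_of_noZeroDivisors
      ((map_ne_zero_iff _ (FaithfulSMul.algebraMap_injective B M)).2 hc0))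
  have hunit : IsUnit (algebraMap M L (algebraMap B M c)) :=
    IsLocalization.Away.algebraMap_isUnit _
  have hloc : IsLocalization.Away cN L := by
    refine IsLocalization.Away.mk (r := cN) hunit (fun s => ?_) (fun a b h => ?_)
    · obtain ⟨n, m, hm⟩ := IsLocalization.Away.surj (algebraMap B M c) s
      obtain ⟨k, hk⟩ := hmul m
      refine ⟨n + k, ⟨c ^ k • m, hk⟩, ?_⟩
      have h1 : algebraMap N L cN = algebraMap M L (algebraMap B M c) := rfl
      have h2 : algebraMap N L ⟨c ^ k • m, hk⟩ = algebraMap M L (c ^ k • m) := rfl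
      rw [h1, h2, pow_add, ← mul_assoc, hm, Algebra.smul_def, map_mul, map_pow, map_pow, mul_comm]
    · exact ⟨0, by rw [Subtype.ext (hinj h)]⟩
  let ψ : L →+* K := IsLocalization.Away.lift cN (g := χ) (by
    rw [isUnit_iff_ne_zero]
    rwa [show χ cN = φ c from congrArg (fun f => f c) hχ])
  refine ⟨ψ.comp (algebraMap M L), ?_⟩
  ext b
  have h1 := IsLocalization.Away.lift_eq (S := L) cN (g := χ) (by
    rw [isUnit_iff_ne_zero]
    rwa [show χ cN = φ c from congrArg (fun f => f c) hχ]) (algebraMap B N b)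
  have h2 : χ (algebraMap B N b) = φ b := congrArg (fun f => f b) hχ
  rw [← h2, ← h1]
  rfl

/-- A ring homomorphism `B[s] → M[s]` over `s ↦ s` is injective as soon as it is at `s = 0`. -/
theorem Polynomial.injective_of_injective_at_zero {B M : Type*} [CommRing B] [CommRing M]
    (Ψ : Polynomial B →+* Polynomial M) (hX : Ψ Polynomial.X = Polynomial.X)
    (h0 : ∀ b : B, (Ψ (Polynomial.C b)).coeff 0 = 0 → b = 0) : Function.Injective Ψ := by
  rw [injective_iff_map_eq_zero]
  intro G
  induction h : G.natDegree using Nat.strong_induction_on generalizing G with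
  | _ m ih =>
    intro hG
    have hG' := G.divX_mul_X_add
    have hc : G.coeff 0 = 0 := by
      apply h0
      have := congrArg (fun p => (Ψ p).coeff 0) hG'
      simpa [hX, hG] using this
    rw [hc, map_zero, add_zero] at hG'
    -- The variable divides `G`, is fixed by `Ψ` and is regular, so it cancels.
    have hd : Ψ G.divX = 0 := by
      have := congrArg Ψ hG'
      rw [map_mul, hX, hG] at this
      exact Polynomial.isRegular_X.right (by simpa using this)
    by_cases hm : G.natDegree = 0
    · rw [Polynomial.eq_C_of_natDegree_eq_zero hm, hc, map_zero]
    · rw [← hG', ih G.divX.natDegree (by rw [Polynomial.natDegree_divX_eq_natDegree_tsub_one]; omega)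
        G.divX rfl hd, zero_mul]

/-! ### Algebraic independence of the generic coefficients -/

section Generic

variable {K A : Type*} [Field K] [CommRing A] [Algebra K A] {d n : ℕ}

/-- The generic affine linear equations in `x`: the coefficient variables together with the
constant terms which make `x` a solution. -/
noncomputable def genericCoeff (d : ℕ) (x : Fin n → A) :
    Fin d × Option (Fin n) → MvPolynomial (Fin d × Fin n) A
  | (i, none) => -∑ j, X (i, j) * C (x j)
  | (i, some j) => X (i, j)

/-- By degeneration. Put `a_ij = δ_ij + s a'_ij`, where row `i` of `δ` is minus the `e i`-th unit
vector. The constant terms become `x_{e i} - s ∑ a'_ij x_j`, so at `s = 0` the family of the `a'_ij`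
and constant terms is visibly independent. Independence at `s = 0` implies independence over `K[s]`.
-/
theorem algebraicIndependent_genericCoeff (x : Fin n → A) (e : Fin d → Fin n)
    (h : AlgebraicIndependent K (x ∘ e)) : AlgebraicIndependent K (genericCoeff d x) := by
  classical
  -- the family obtained by specialising the coefficients
  let v : Fin d × Option (Fin n) → MvPolynomial (Fin d × Fin n) A := fun q => match q with
    | (i, none) => C (x (e i))
    | (i, some j) => X (i, j)
  have hv : AlgebraicIndependent K v := by
    have h1 := h.sumElim_comp (algebraicIndependent_X (Fin d × Fin n) A)
    let E : Fin d × Option (Fin n) → (Fin d × Fin n) ⊕ Fin d := fun q => match q with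
      | (i, none) => Sum.inr i
      | (i, some j) => Sum.inl (i, j)
    have hE : Function.Injective E := by
      rintro ⟨i, _ | j⟩ ⟨i', _ | j'⟩ hij <;> simp_all [E]
    have h2 := h1.comp E hE
    convert h2 using 1
    ext1 ⟨i, _ | j⟩ <;> simp [E, v]
  let δ : Fin d → Fin n → K := fun i j => if j = e i then -1 else 0
  have hδ : ∀ i, ∑ j, algebraMap K A (δ i j) * x j = - x (e i) := fun i => by
    simp [δ, apply_ite (algebraMap K A)]
  let σ : MvPolynomial (Fin d × Option (Fin n)) K →ₐ[K]
      Polynomial (MvPolynomial (Fin d × Option (Fin n)) K) :=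
    aeval fun q => match q with
      | (i, none) => Polynomial.C (X (i, none))
      | (i, some j) => Polynomial.C (C (δ i j)) + Polynomial.X * Polynomial.C (X (i, some j))
  let τ : MvPolynomial (Fin d × Fin n) A →ₐ[A] Polynomial (MvPolynomial (Fin d × Fin n) A) :=
    aeval fun q => Polynomial.C (C (algebraMap K A (δ q.1 q.2))) +
      Polynomial.X * Polynomial.C (X q)
  let w : Fin d × Option (Fin n) → Polynomial (MvPolynomial (Fin d × Fin n) A) := fun q =>
    match q with
    | (i, none) => Polynomial.C (C (x (e i))) -
        Polynomial.X * Polynomial.C (∑ j, X (i, j) * C (x j))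
    | (i, some j) => Polynomial.C (X (i, j))
  let Ψ : Polynomial (MvPolynomial (Fin d × Option (Fin n)) K) →+*
      Polynomial (MvPolynomial (Fin d × Fin n) A) :=
    Polynomial.eval₂RingHom (aeval w : _ →ₐ[K] _).toRingHom Polynomial.X
  have hΨ : Function.Injective Ψ := by
    refine Polynomial.injective_of_injective_at_zero Ψ (by simp [Ψ]) fun b hb => ?_
    have hcomp : ((Polynomial.aeval (R := MvPolynomial (Fin d × Fin n) A) 0).restrictScalars K).comp
        (aeval w) = (aeval v : _ →ₐ[K] _) := by
      ext1 ⟨i, _ | j⟩ <;> simp [w, v]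
    have hΨC : Ψ (Polynomial.C b) = aeval w b := Polynomial.eval₂_C _ _
    rw [hΨC, Polynomial.coeff_zero_eq_eval_zero] at hb
    apply hv
    rw [map_zero, ← hcomp]
    exact hb
  -- At `s = 1` the substitution is a translation of the variables, undone by `ρ`.
  have hσ : Function.Injective σ := by
    let ρ : MvPolynomial (Fin d × Option (Fin n)) K →ₐ[K] MvPolynomial (Fin d × Option (Fin n)) K :=
      aeval fun q => match q with
      | (i, none) => X (i, none)
      | (i, some j) => X (i, some j) - C (δ i j)
    have : (ρ.comp ((Polynomial.aeval
        (R := MvPolynomial (Fin d × Option (Fin n)) K) 1).restrictScalars K)).comp σ =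
        AlgHom.id K _ := by
      ext1 ⟨i, _ | j⟩ <;> simp [ρ, σ]
    exact Function.LeftInverse.injective (g := ρ.comp ((Polynomial.aeval
        (R := MvPolynomial (Fin d × Option (Fin n)) K) 1).restrictScalars K))
        fun F => congrArg (fun f => f F) this
  have hcomm : Ψ.comp σ.toRingHom =
      τ.toRingHom.comp (aeval (genericCoeff d x) : _ →ₐ[K] _).toRingHom := by
    refine MvPolynomial.ringHom_ext (fun r => ?_) fun q => ?_
    · simp [Ψ, σ, τ]
    · obtain ⟨i, _ | j⟩ := q
      · simp [Ψ, σ, τ, genericCoeff, w]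
        have hx : x (e i) = -∑ j, algebraMap K A (δ i j) * x j := by rw [hδ, neg_neg]
        rw [hx]
        simp only [map_neg, map_sum, map_mul, add_mul, Finset.sum_add_distrib, Finset.mul_sum,
          neg_add, sub_eq_add_neg]
        refine congrArg _ (congrArg _ (Finset.sum_congr rfl fun j _ => by ring))
      · simp [Ψ, σ, τ, genericCoeff, w]
  rw [AlgebraicIndependent, injective_iff_map_eq_zero]
  intro F hF
  refine (map_eq_zero_iff σ hσ).1 ((map_eq_zero_iff Ψ hΨ).1 ?_)
  have := congrArg (fun f => f F) hcomm
  refine Eq.trans this ?_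
  change τ (aeval (genericCoeff d x) F) = 0
  rw [hF, map_zero]

end Generic

/-! ### Generic linear sections of an irreducible algebraic set -/

section Core

variable {K : Type*} [Field K] {n : ℕ}

/-- Some `d` of the generators of a domain of dimension `d` are a transcendence basis. -/
theorem exists_isTranscendenceBasis_comp {A : Type*} [CommRing A] [IsDomain A] [Algebra K A]
    (x : Fin n → A) (hx : Algebra.adjoin K (Set.range x) = ⊤) {d : ℕ}
    (hd : ringKrullDim A = d) :
    ∃ e : Fin d → Fin n, Function.Injective e ∧ IsTranscendenceBasis K (x ∘ e) := by
  have hft : Algebra.FiniteType K A := ⟨⟨(Set.finite_range x).toFinset, by simpa using hx⟩⟩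
  obtain ⟨s, hs, hsd⟩ := ringKrullDim_eq_trdeg K A
  have hsd' : s = d := by rw [hd] at hsd; exact_mod_cast hsd.symm
  subst hsd'
  have : Algebra.IsAlgebraic (Algebra.adjoin K (Set.range x)) A :=
    ⟨fun a => isAlgebraic_algebraMap (⟨a, hx ▸ trivial⟩ : Algebra.adjoin K (Set.range x))⟩
  obtain ⟨t, ht, hb⟩ := exists_isTranscendenceBasis_subset (R := K) (Set.range x)
  have hcard := hb.lift_cardinalMk_eq_trdeg
  rw [hs, Cardinal.lift_natCast, Cardinal.lift_id] at hcard
  have : Finite t := Cardinal.lt_aleph0_iff_finite.1 (hcard ▸ Cardinal.natCast_lt_aleph0)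
  have hnat : Nat.card t = s := by rw [Nat.card, hcard, Cardinal.toNat_natCast]
  let E : Fin s ≃ t := (Finite.equivFinOfCardEq hnat).symm
  choose e he using fun i => ht (E i).2
  have hcomp : x ∘ e = Subtype.val ∘ E := funext he
  refine ⟨e, ?_, ?_⟩
  · refine Function.Injective.of_comp (f := x) ?_
    rw [hcomp]
    exact Subtype.val_injective.comp E.injective
  · rw [hcomp]
    exact (isTranscendenceBasis_equiv E).2 hb

/-- An independent family of `d(n+1) = dn + d` elements is as large as the transcendence degree of
`A[a_ij]` permits. -/
theorem isTranscendenceBasis_genericCoeff {A : Type*} [CommRing A] [IsDomain A] [Algebra K A]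
    {d : ℕ} (x : Fin n → A) (e : Fin d → Fin n) (h : IsTranscendenceBasis K (x ∘ e)) :
    IsTranscendenceBasis K (genericCoeff d x) := by
  refine (algebraicIndependent_genericCoeff x e h.1).isTranscendenceBasis_of_lift_trdeg_le_of_finite
    ?_
  have h1 := (h.sumElim_comp
    (IsTranscendenceBasis.mvPolynomial (Fin d × Fin n) A)).lift_cardinalMk_eq_trdeg
  simp only [Cardinal.lift_id'] at h1 ⊢
  have : (Cardinal.mk (Fin d × Option (Fin n))) = Cardinal.mk ((Fin d × Fin n) ⊕ Fin d) := by
    simp [mul_add]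
  rw [this]
  simpa using h1.ge

/-- For a domain `A` of dimension `d` generated by `x` and a nonzero `h`, a generic linear section
of codimension `d` of `A` has points, and `h` does not vanish at them. -/
theorem exists_generic_specialization [IsAlgClosed K] {A : Type*} [CommRing A] [IsDomain A]
    [Algebra K A] (x : Fin n → A) (hx : Algebra.adjoin K (Set.range x) = ⊤) {d : ℕ}
    (hd : ringKrullDim A = d) {h : A} (hh : h ≠ 0) :
    ∃ P : MvPolynomial (Fin d × Option (Fin n)) K, P ≠ 0 ∧
      ∀ a : Fin d × Option (Fin n) → K, eval a P ≠ 0 →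
        (∃ χ : A →ₐ[K] K, ∀ i, a (i, none) + ∑ j, a (i, some j) * χ (x j) = 0) ∧
        ∀ χ : A →ₐ[K] K, (∀ i, a (i, none) + ∑ j, a (i, some j) * χ (x j) = 0) → χ h ≠ 0 := by
  obtain ⟨e, -, he⟩ := exists_isTranscendenceBasis_comp x hx hd
  have hv := isTranscendenceBasis_genericCoeff x e he
  algebraize [(aeval (genericCoeff d x) : MvPolynomial (Fin d × Option (Fin n)) K →ₐ[K] _).toRingHom]
  have hmap : ∀ b, algebraMap (MvPolynomial (Fin d × Option (Fin n)) K)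
    (MvPolynomial (Fin d × Fin n) A) b = aeval (genericCoeff d x) b := fun _ => rfl
  have hfaith : FaithfulSMul (MvPolynomial (Fin d × Option (Fin n)) K)
      (MvPolynomial (Fin d × Fin n) A) :=
    (faithfulSMul_iff_algebraMap_injective _ _).2 hv.1
  have halg : Algebra.IsAlgebraic (MvPolynomial (Fin d × Option (Fin n)) K)
      (MvPolynomial (Fin d × Fin n) A) := by
    have := hv.isAlgebraic
    refine ⟨fun m => ?_⟩
    refine IsAlgebraic.of_ringHom_of_comp_eq hv.1.aevalEquiv (RingHom.id _)
      (this.isAlgebraic m) hv.1.aevalEquiv.surjective Function.injective_id ?_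
    exact RingHom.ext fun b => hv.1.algebraMap_aevalEquiv b
  have hfin : Algebra.FiniteType (MvPolynomial (Fin d × Option (Fin n)) K)
      (MvPolynomial (Fin d × Fin n) A) := by
    have : Algebra.FiniteType K A := ⟨⟨(Set.finite_range x).toFinset, by simpa using hx⟩⟩
    have : Algebra.FiniteType K (MvPolynomial (Fin d × Fin n) A) :=
      Algebra.FiniteType.trans (S := A) inferInstance inferInstance
    exact Algebra.FiniteType.of_restrictScalars_finiteType K _ _
  obtain ⟨c, hc, hext⟩ := exists_forall_ringHom_extend (MvPolynomial (Fin d × Option (Fin n)) K)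
    (MvPolynomial (Fin d × Fin n) A) K
  -- Algebraicity gives `h` a nonzero multiple `r` among the polynomials in the coefficients.
  obtain ⟨r, hr, m, hm⟩ := (halg.isAlgebraic (C h)).exists_nonzero_dvd
    (mem_nonZeroDivisors_of_ne_zero (C_ne_zero.2 hh))
  refine ⟨c * r, mul_ne_zero hc hr, fun a ha => ?_⟩
  rw [map_mul] at ha
  constructor
  · obtain ⟨ψ, hψ⟩ := hext (eval a) (left_ne_zero_of_mul ha)
    have hψ' : ∀ b, ψ (aeval (genericCoeff d x) b) = eval a b := fun b =>
      congrArg (fun f => f b) hψ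
    let χ : A →ₐ[K] K :=
      { ψ.comp C with
        commutes' := fun k => by
          have := hψ' (C k)
          rw [aeval_C, eval_C] at this
          exact this }
    refine ⟨χ, fun i => ?_⟩
    have h1 := hψ' (X (i, none))
    have h2 := fun j => hψ' (X (i, some j))
    simp only [aeval_X, eval_X, genericCoeff, map_neg, map_sum, map_mul] at h1 h2
    simp only [← h1, ← h2]
    exact neg_add_cancel _
  · intro χ hχ h0
    -- A point of the section extends to a point of the incidence variety over `a`; if `h` vanished
    -- there, so would its multiple `r`, giving `r(a) = 0`.
    let ψ : MvPolynomial (Fin d × Fin n) A →ₐ[K] K :=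
      { eval₂Hom χ.toRingHom fun q => a (q.1, some q.2) with
        commutes' := fun k => by
          change eval₂Hom χ.toRingHom _ (C (algebraMap K A k)) = _
          rw [eval₂Hom_C]
          exact χ.commutes k }
    have hψC : ∀ z, ψ (C z) = χ z := fun z => eval₂Hom_C _ _ _
    have hψX : ∀ q, ψ (X q) = a (q.1, some q.2) := fun z => eval₂Hom_X' _ _ _
    have hψ : ψ.comp (aeval (genericCoeff d x)) = aeval a := by
      ext1 ⟨i, _ | j⟩
      · simp only [AlgHom.comp_apply, aeval_X, genericCoeff, map_neg, map_sum, map_mul, hψC, hψX]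
        linear_combination -hχ i
      · simp only [AlgHom.comp_apply, aeval_X, genericCoeff, hψX]
    apply right_ne_zero_of_mul ha
    have := congrArg (fun f => f r) hψ
    rw [← coe_aeval_eq_eval]
    refine Eq.trans this.symm ?_
    change ψ (aeval (genericCoeff d x) r) = 0
    rw [← hmap, hm, map_mul, hψC, h0, zero_mul]

/-- A generic linear section of codimension `d` of an irreducible algebraic set of dimension `d` is
nonempty and misses a given proper hypersurface section. -/
theorem exists_generic_linearSection [IsAlgClosed K] (p : Ideal (MvPolynomial (Fin n) K))
    [p.IsPrime] {d : ℕ} (hd : ringKrullDim (MvPolynomial (Fin n) K ⧸ p) = d)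
    {h : MvPolynomial (Fin n) K} (hp : h ∉ p) :
    ∃ P : MvPolynomial (Fin d × Option (Fin n)) K, P ≠ 0 ∧
      ∀ a : Fin d × Option (Fin n) → K, eval a P ≠ 0 →
        (∃ x ∈ zeroLocus K p, x ∈ linearSection a) ∧
        ∀ x ∈ zeroLocus K p, x ∈ linearSection a → eval x h ≠ 0 := by
  have hx : Algebra.adjoin K (Set.range fun j => Ideal.Quotient.mkₐ K p (X j)) = ⊤ := by
    rw [show (Set.range fun j => Ideal.Quotient.mkₐ K p (X j)) =
        Ideal.Quotient.mkₐ K p '' Set.range X from Set.range_comp _ X,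
      ← AlgHom.map_adjoin, adjoin_range_X, Algebra.map_top]
    exact (AlgHom.range_eq_top _).2 (Ideal.Quotient.mkₐ_surjective K p)
  obtain ⟨P, hP, H⟩ := exists_generic_specialization _ hx hd
    (h := Ideal.Quotient.mkₐ K p h) fun h0 => hp (Ideal.Quotient.eq_zero_iff_mem.1 h0)
  refine ⟨P, hP, fun a ha => ⟨?_, fun y hy hya => ?_⟩⟩
  · obtain ⟨χ, hχ⟩ := (H a ha).1
    refine ⟨fun j => χ (Ideal.Quotient.mkₐ K p (X j)), fun q hq => ?_, hχ⟩
    have : aeval (fun j => χ (Ideal.Quotient.mkₐ K p (X j))) = χ.comp (Ideal.Quotient.mkₐ K p) := by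
      ext; simp
    rw [this, AlgHom.comp_apply,
      show Ideal.Quotient.mkₐ K p q = 0 from Ideal.Quotient.eq_zero_iff_mem.2 hq, map_zero]
  · have hlift : ∀ q, Ideal.Quotient.liftₐ p (aeval y) hy (Ideal.Quotient.mkₐ K p q) = eval y q :=
      fun q => by rw [← coe_aeval_eq_eval]; exact Ideal.Quotient.lift_mk _ _ _
    rw [← hlift h]
    refine (H a ha).2 _ fun i => ?_
    simp only [hlift, eval_X]
    exact hya i

/-- A generic system of `d ≤ n` equations defines a linear subspace of codimension `d`. -/
theorem exists_generic_finrank_direction {d : ℕ} (e : Fin d → Fin n) (he : Function.Injective e) :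
    ∃ P : MvPolynomial (Fin d × Option (Fin n)) K, P ≠ 0 ∧
      ∀ a : Fin d × Option (Fin n) → K, eval a P ≠ 0 →
        (linearSection a : Set (Fin n → K)).Nonempty ∧
          Module.finrank K (linearSection a).direction + d = n := by
  -- If the minor on the columns `e` is nonzero, the linear part is onto `K^d`, and rank-nullity
  -- gives the codimension.
  let m : Matrix (Fin d) (Fin d) (MvPolynomial (Fin d × Option (Fin n)) K) :=
    Matrix.of fun i k => X (i, some (e k))
  have heval : ∀ a : Fin d × Option (Fin n) → K, eval a m.det =
      (Matrix.of fun i k => a (i, some (e k))).det := fun a => by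
    rw [RingHom.map_det]
    congr 1
    ext i k
    simp [m]
  refine ⟨m.det, fun h0 => ?_, fun a ha => ?_⟩
  · classical
    let a : Fin d × Option (Fin n) → K := fun q => if q.2 = some (e q.1) then 1 else 0
    have h1 := heval a
    have : (Matrix.of fun i k => a (i, some (e k))) = (1 : Matrix (Fin d) (Fin d) K) := by
      ext i k
      simp [a, Matrix.one_apply, he.eq_iff, eq_comm]
    rw [h0, this] at h1
    simp at h1
  · rw [heval] at ha
    let N : Matrix (Fin d) (Fin n) K := Matrix.of fun i j => a (i, some j)
    let f : (Fin n → K) →ₗ[K] (Fin d → K) := N.mulVecLin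
    have hf : Function.Surjective f := by
      intro b
      obtain ⟨z, hz⟩ := (Matrix.mulVec_surjective_iff_isUnit.2
        ((Matrix.isUnit_iff_isUnit_det _).2 (isUnit_iff_ne_zero.2 ha))) b
      refine ⟨∑ k, z k • Pi.single (e k) 1, ?_⟩
      rw [← hz]
      ext i
      simp [f, N, Matrix.mulVec, dotProduct, Finset.sum_apply]
      exact Finset.sum_congr rfl fun k _ => mul_comm _ _
    obtain ⟨x₀, hx₀⟩ := hf fun i => -a (i, none)
    have hmem : ∀ x, x ∈ linearSection a ↔ f x = fun i => -a (i, none) := fun x => by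
      rw [funext_iff]
      refine forall_congr' fun i => ?_
      rw [eq_neg_iff_add_eq_zero, add_comm]
      rfl
    have hx₀' : x₀ ∈ linearSection a := (hmem _).2 hx₀
    refine ⟨⟨x₀, hx₀'⟩, ?_⟩
    have hdir : (linearSection a).direction = LinearMap.ker f := by
      ext v
      rw [AffineSubspace.mem_direction_iff_eq_vsub_right hx₀', LinearMap.mem_ker]
      constructor
      · rintro ⟨y, hy, rfl⟩
        rw [vsub_eq_sub, map_sub, (hmem y).1 hy, hx₀, sub_self]
      · intro hv
        exact ⟨v + x₀, (hmem _).2 (by rw [map_add, hv, zero_add, hx₀]), by simp⟩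
    have := f.finrank_range_add_finrank_ker
    rw [LinearMap.range_eq_top.2 hf, finrank_top] at this
    simp at this
    rw [hdir]
    omega

end Core

/-! ### Components, minimal primes and affine cells -/

section Zariski

variable {K : Type*} [Field K] {n : ℕ}

theorem isPrime_vanishingIdeal {T : Set (Fin n → K)}
    (hT : @IsIrreducible _ (zariskiTopology K n) T) : (vanishingIdeal K T).IsPrime := by
  let := zariskiTopology K n
  refine ⟨fun h => ?_, fun {p q} hpq => ?_⟩
  · obtain ⟨x, hx⟩ := hT.1
    have h1 : (1 : MvPolynomial (Fin n) K) ∈ vanishingIdeal K T := h ▸ trivial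
    simpa using h1 x hx
  · have hclosed : ∀ r : MvPolynomial (Fin n) K, IsClosed {x : Fin n → K | aeval x r = 0} :=
      fun r => isClosed_zariski_iff.2 ⟨Ideal.span {r}, by rw [zeroLocus_span]; simp⟩
    have h := isPreirreducible_iff_isClosed_union_isClosed.1 hT.2 _ _ (hclosed p) (hclosed q)
      fun x hx => by simpa using hpq x hx
    exact h.imp (fun h x hx => h hx) (fun h x hx => h hx)

theorem isRadical_vanishingIdeal (S : Set (Fin n → K)) : (vanishingIdeal K S).IsRadical := by
  rintro f ⟨m, hm⟩ x hx
  have := hm x hx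
  rw [map_pow] at this
  exact eq_zero_of_pow_eq_zero this

/-- `X ∖ V(f)` is dense in `X` iff `f` vanishes on no irreducible component of the closure. -/
theorem vanishingIdeal_diff_hypersurface_le_iff (S : Set (Fin n → K)) (f : MvPolynomial (Fin n) K) :
    vanishingIdeal K (S \ hypersurface f) ≤ vanishingIdeal K S ↔
      ∀ p ∈ (vanishingIdeal K S).minimalPrimes, f ∉ p := by
  have hmul : ∀ q, q ∈ vanishingIdeal K (S \ hypersurface f) ↔ f * q ∈ vanishingIdeal K S := by
    intro q
    simp only [mem_vanishingIdeal_iff, hypersurface, Set.mem_sdiff, Set.mem_ofPred_eq, map_mul,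
      mul_eq_zero, ← coe_aeval_eq_eval]
    exact forall_congr' fun x => ⟨fun h hx => or_iff_not_imp_left.2 fun hf => h ⟨hx, hf⟩,
      fun h hx => (h hx.1).resolve_left hx.2⟩
  constructor
  · intro h p hp hf
    -- Elements of a minimal prime over an ideal are zero divisors modulo that ideal.
    obtain ⟨q, hq, hfq⟩ := Ideal.exists_mul_mem_of_mem_minimalPrimes hp hf
    exact hq (h ((hmul q).2 hfq))
  · intro h q hq
    rw [← (isRadical_vanishingIdeal S).radical, ← Ideal.sInf_minimalPrimes, Ideal.mem_sInf]
    intro p hp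
    exact (hp.1.1.mem_or_mem (hp.1.2 ((hmul q).1 hq))).resolve_left (h p hp)

variable [IsAlgClosed K]

/-- By the Nullstellensatz, containment of `zeroLocus K p` in a closed set is containment of ideals
in `p`, so primality becomes irreducibility. -/
theorem isIrreducible_zeroLocus (p : Ideal (MvPolynomial (Fin n) K)) [hp : p.IsPrime] :
    @IsIrreducible _ (zariskiTopology K n) (zeroLocus K p) := by
  let := zariskiTopology K n
  have hle : ∀ I : Ideal (MvPolynomial (Fin n) K), zeroLocus K p ⊆ zeroLocus K I ↔ I ≤ p := fun I => by
    refine ⟨fun h => ?_, fun h => zeroLocus_anti_mono h⟩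
    have := le_zeroLocus_iff_le_vanishingIdeal.1 h
    rwa [IsPrime.vanishingIdeal_zeroLocus] at this
  constructor
  · rw [Set.nonempty_iff_ne_empty]
    intro h
    exact hp.ne_top (top_le_iff.1 ((hle ⊤).1 (by rw [h]; exact Set.empty_subset _)))
  · rw [isPreirreducible_iff_isClosed_union_isClosed]
    intro Z₁ Z₂ h₁ h₂ h
    obtain ⟨I₁, rfl⟩ := isClosed_zariski_iff.1 h₁
    obtain ⟨I₂, rfl⟩ := isClosed_zariski_iff.1 h₂
    rw [hle, hle, ← hp.mul_le, ← hle]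
    intro x hx
    rcases h hx with h | h
    · exact zeroLocus_anti_mono Ideal.mul_le_left h
    · exact zeroLocus_anti_mono Ideal.mul_le_right h

theorem isIrreducibleComponent_zeroLocus {S : Set (Fin n → K)} {p : Ideal (MvPolynomial (Fin n) K)}
    (hp : p ∈ (vanishingIdeal K S).minimalPrimes) :
    IsIrreducibleComponent (zeroLocus K p) (zariskiClosure S) := by
  have hprime := hp.1.1
  rw [zariskiClosure_eq]
  refine ⟨⟨isIrreducible_zeroLocus p, zeroLocus_anti_mono hp.1.2⟩, fun T hT hle => ?_⟩
  have h1 : vanishingIdeal K T ≤ p := by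
    rw [← IsPrime.vanishingIdeal_zeroLocus (K := K) p]
    exact vanishingIdeal_anti_mono hle
  have h2 := hp.2 ⟨isPrime_vanishingIdeal hT.1, le_zeroLocus_iff_le_vanishingIdeal.1 hT.2⟩ h1
  exact le_zeroLocus_iff_le_vanishingIdeal.2 h2

/-- This is why the choice of distinguished ideals does not matter. -/
theorem AffineCell.radical_ideal (X : AffineCell K n) :
    X.ideal.radical = vanishingIdeal K X.carrier := by
  rw [← vanishingIdeal_zeroLocus_eq_radical (K := K), X.zeroLocus_ideal, zariskiClosure_eq]
  refine le_antisymm (vanishingIdeal_anti_mono (zeroLocus_vanishingIdeal_le _))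
    (le_vanishingIdeal_zeroLocus _)

theorem AffineCell.IsEquidimensional.ringKrullDim_eq {X : AffineCell K n} (hX : X.IsEquidimensional)
    {p : Ideal (MvPolynomial (Fin n) K)} (hp : p ∈ (vanishingIdeal K X.carrier).minimalPrimes) :
    ringKrullDim (MvPolynomial (Fin n) K ⧸ p) = zariskiDim X.carrier := by
  refine ringKrullDim_quotient_minimalPrime_eq (fun q hq => ?_) hp
  have hp' := hp.1.1
  have hq' := hq.1.1
  have := hX _ _ (isIrreducibleComponent_zeroLocus hq) (isIrreducibleComponent_zeroLocus hp)
  rwa [zariskiDim, zariskiDim, IsPrime.vanishingIdeal_zeroLocus,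
    IsPrime.vanishingIdeal_zeroLocus] at this

/-- An equidimensional affine cell: a generic linear section of complementary dimension meets every
component of the closure, at points of the cell where a given polynomial vanishes only if it
vanishes on the component. -/
theorem AffineCell.IsEquidimensional.exists_generic_linearSection {X : AffineCell K n}
    (hX : X.IsEquidimensional) {d : ℕ} (hd : zariskiDim X.carrier = (d : WithBot ℕ∞))
    (f : MvPolynomial (Fin n) K) :
    ∃ P : MvPolynomial (Fin d × Option (Fin n)) K, P ≠ 0 ∧
      ∀ a : Fin d × Option (Fin n) → K, eval a P ≠ 0 →
        ∀ p ∈ (vanishingIdeal K X.carrier).minimalPrimes,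
          (∃ x ∈ zeroLocus K p ∩ X.carrier, x ∈ linearSection a) ∧
          (f ∉ p → ∀ x ∈ zeroLocus K p, x ∈ linearSection a → eval x f ≠ 0) := by
  classical
  obtain ⟨J, g, hJ⟩ := X.isAffineCell
  -- Removing `V(g)` does not change `X`, so the density criterion applies to `g`.
  have hg : ∀ p ∈ (vanishingIdeal K X.carrier).minimalPrimes, g ∉ p := by
    rw [← vanishingIdeal_diff_hypersurface_le_iff]
    exact vanishingIdeal_anti_mono fun x hx => ⟨hx, (hJ ▸ hx).2⟩
  have hJI : J ≤ vanishingIdeal K X.carrier :=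
    le_zeroLocus_iff_le_vanishingIdeal.1 (hJ ▸ Set.sdiff_subset)
  have hex : ∀ p ∈ (vanishingIdeal K X.carrier).minimalPrimes,
      ∃ P : MvPolynomial (Fin d × Option (Fin n)) K, P ≠ 0 ∧
        ∀ a : Fin d × Option (Fin n) → K, eval a P ≠ 0 →
          (∃ x ∈ zeroLocus K p ∩ X.carrier, x ∈ linearSection a) ∧
          (f ∉ p → ∀ x ∈ zeroLocus K p, x ∈ linearSection a → eval x f ≠ 0) := by
    intro p hp
    have hp' := hp.1.1
    have hdim := (hX.ringKrullDim_eq hp).trans hd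
    have hgp := hg p hp
    -- Nonvanishing of `g` puts the points of the section in `X`; the factor `f` can be included
    -- only when it is nonzero on the component.
    let k := if f ∈ p then g else g * f
    have hk : k ∉ p := by
      by_cases hf : f ∈ p
      · simpa [k, hf] using hgp
      · simpa [k, hf] using hp'.mul_notMem hgp hf
    obtain ⟨P, hP, H⟩ := _root_.exists_generic_linearSection p hdim hk
    refine ⟨P, hP, fun a ha => ⟨?_, fun hf x hx hxa h0 => ?_⟩⟩
    · obtain ⟨x, hx, hxa⟩ := (H a ha).1
      refine ⟨x, ⟨hx, ?_⟩, hxa⟩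
      rw [hJ]
      refine ⟨zeroLocus_anti_mono (hJI.trans hp.1.2) hx, fun h0 => (H a ha).2 x hx hxa ?_⟩
      have h0 : eval x g = 0 := h0
      by_cases hf : f ∈ p <;> simp [k, hf, h0]
    · exact (H a ha).2 x hx hxa (by simp [k, hf, h0])
  choose! P hP H using hex
  have hfin := Ideal.finite_minimalPrimes_of_isNoetherianRing _ (vanishingIdeal K X.carrier)
  refine ⟨∏ p ∈ hfin.toFinset, P p,
    Finset.prod_ne_zero_iff.2 fun p hp => hP p (hfin.mem_toFinset.1 hp), fun a ha p hp => ?_⟩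
  rw [map_prod, Finset.prod_ne_zero_iff] at ha
  exact H p hp a (ha p (hfin.mem_toFinset.2 hp))

end Zariski

/-! ### The two equivalences -/

theorem mainTheorem3 {K : Type*} [Field K] [IsAlgClosed K] {n : ℕ}
    (X : AffineCell K n) (hX : X.IsEquidimensional)
    (d : ℕ) (hd : zariskiDim X.carrier = (d : WithBot ℕ∞))
    (f : MvPolynomial (Fin n) K) :
    ForGenericSubspace d (fun L : AffineSubspace K (Fin n → K) =>
      (∀ W : AffineCell K n, W.carrier = X.carrier ∩ (L : Set (Fin n → K)) →
        (f ∈ X.ideal.radical ↔ f ∈ W.ideal.radical)) ∧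
      (∀ Y : AffineCell K n, Y.carrier = X.carrier \ hypersurface f →
        (Y.ideal ≤ X.ideal.radical ↔
          X.carrier ∩ (L : Set (Fin n → K)) ∩ hypersurface f = ∅))) := by
  set I := vanishingIdeal K X.carrier with hI
  have hrad : I.radical = I := (isRadical_vanishingIdeal _).radical
  -- The dimension `d` of a quotient of the polynomial ring is at most `n`, so `d` columns can be
  -- chosen.
  obtain ⟨e, he⟩ : ∃ e : Fin d → Fin n, Function.Injective e := by
    have hle : ringKrullDim (MvPolynomial (Fin n) K ⧸ I) ≤ ringKrullDim (MvPolynomial (Fin n) K) :=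
      ringKrullDim_quotient_le I
    rw [MvPolynomial.ringKrullDim_of_isNoetherianRing] at hle
    have hdn : d ≤ n := by
      have : (d : WithBot ℕ∞) ≤ n := by rw [← hd, zariskiDim]; simpa using hle
      exact_mod_cast this
    exact ⟨Fin.castLE hdn, Fin.castLE_injective hdn⟩
  obtain ⟨P, hP, HP⟩ := exists_generic_finrank_direction (K := K) e he
  obtain ⟨Q, hQ, HQ⟩ := hX.exists_generic_linearSection hd f
  refine ⟨P * Q, mul_ne_zero hP hQ, fun a ha => ?_⟩
  rw [map_mul] at ha
  refine ⟨HP a (left_ne_zero_of_mul ha), fun W hW => ?_, fun Y hY => ?_⟩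
  all_goals have H := HQ a (right_ne_zero_of_mul ha)
  · rw [X.radical_ideal, W.radical_ideal, hW]
    refine ⟨fun h => vanishingIdeal_anti_mono Set.inter_subset_left h, fun h => ?_⟩
    rw [← hI, ← hrad, ← Ideal.sInf_minimalPrimes, Ideal.mem_sInf]
    intro p hp
    by_contra hf
    obtain ⟨⟨x, ⟨hxp, hxX⟩, hxa⟩, hx⟩ := H p hp
    exact hx hf x hxp hxa (by simpa [aeval_eq_eval] using h x ⟨hxX, hxa⟩)
  -- Passing to radicals turns the inclusion into density of `X ∖ V(f)` in `X`.
  · have : Y.ideal ≤ X.ideal.radical ↔ Y.ideal.radical ≤ X.ideal.radical :=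
      X.ideal.radical_isRadical.radical_le_iff.symm
    rw [this, X.radical_ideal, Y.radical_ideal, hY, vanishingIdeal_diff_hypersurface_le_iff]
    constructor
    · intro h
      rw [Set.eq_empty_iff_forall_notMem]
      rintro x ⟨⟨hxX, hxa⟩, hxf⟩
      obtain ⟨p, hp, hpx⟩ := Ideal.exists_minimalPrimes_le (I := I)
        (vanishingIdeal_anti_mono (k := K) (Set.singleton_subset_iff.2 hxX))
      exact (H p hp).2 (h p hp) x (fun q hq => hpx hq x rfl) hxa hxf
    · intro h p hp hf
      obtain ⟨⟨x, ⟨hxp, hxX⟩, hxa⟩, -⟩ := H p hp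
      have : x ∈ X.carrier ∩ (linearSection a : Set (Fin n → K)) ∩ hypersurface f :=
        ⟨⟨hxX, hxa⟩, by simpa [hypersurface, aeval_eq_eval] using hxp f hf⟩
      rw [h] at this
      exact this
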